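/- Fix sets $\mathsf{Prop}$ of propositional variables and $\mathsf{AtProg}$ of atomic programs. Formulas and programs are given by $\varphi ::= \bot \mid p \mid \varphi\to\varphi \mid [\pi]\varphi \mid [\pi]^-\varphi$ and $\pi ::= \alpha \mid \pi;\pi \mid \pi\cup\pi \mid \pi^* \mid \varphi?$, with $p\in\mathsf{Prop}$, $\alpha\in\mathsf{AtProg}$; write $\neg\varphi$ for $\varphi\to\bot$ and $\langle\pi\rangle^-\varphi$ for $\neg[\pi]^-\neg\varphi$. A sequent $\Gamma\vdash\Delta$ is a pair of finite sets of formulas; commas denote union, and $[\pi]\Gamma=\{[\pi]\varphi:\varphi\in\Gamma\}$, $[\pi]^-\Gamma=\{[\pi]^-\varphi:\varphi\in\Gamma\}$. The sequent calculus GTPDL has the following rules (assumptions / conclusion): - (Ax) $\;/\;\Gamma\vdash\Delta$ if $\Gamma\cap\Delta\neq\emptyset$; ($\bot$) $\;/\;\Gamma,\bot\vdash\Delta$; - ($\to$L) $\Gamma\vdash\varphi,\Delta$ and $\Gamma,\psi\vdash\Delta\;/\;\Gamma,\varphi\to\psi\vdash\Delta$; ($\to$R) $\Gamma,\varphi\vdash\psi,\Delta\;/\;\Gamma\vdash\varphi\to\psi,\Delta$;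 - (Wk) $\Gamma\vdash\Delta\;/\;\Gamma'\vdash\Delta'$ if $\Gamma\subseteq\Gamma'$, $\Delta\subseteq\Delta'$; (Cut) $\Gamma\vdash\varphi,\Delta$ and $\Gamma,\varphi\vdash\Delta\;/\;\Gamma\vdash\Delta$; - ($[\,]$) $\Gamma\vdash\varphi,[\pi]^-\Delta\;/\;[\pi]\Gamma\vdash[\pi]\varphi,\Delta$; ($[\,]^-$) $\Gamma\vdash\varphi,[\pi]\Delta\;/\;[\pi]^-\Gamma\vdash[\pi]^-\varphi,\Delta$; - ($;$L) $\Gamma,[\pi_0][\pi_1]\varphi\vdash\Delta\;/\;\Gamma,[\pi_0;\pi_1]\varphi\vdash\Delta$; ($;$R) $\Gamma\vdash[\pi_0][\pi_1]\varphi,\Delta\;/\;\Gamma\vdash[\pi_0;\pi_1]\varphi,\Delta$; - ($\cup$L) $\Gamma,[\pi_0]\varphi,[\pi_1]\varphi\vdash\Delta\;/\;\Gamma,[\pi_0\cup\pi_1]\varphi\vdash\Delta$; ($\cup$R) $\Gamma\vdash\Delta,[\pi_0]\varphi$ and $\Gamma\vdash\Delta,[\pi_1]\varphi\;/\;\Gamma\vdash[\pi_0\cup\pi_1]\varphi,\Delta$;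 - ($*$L) $\Gamma,\varphi,[\pi][\pi^*]\varphi\vdash\Delta\;/\;\Gamma,[\pi^*]\varphi\vdash\Delta$; ($*$R) $\Gamma,\varphi\vdash[\pi]\varphi\;/\;[\pi^*]\Gamma,\varphi\vdash[\pi^*]\varphi$; - ($?$L) $\Gamma\vdash\varphi,\Delta$ and $\Gamma,\psi\vdash\Delta\;/\;\Gamma,[\varphi?]\psi\vdash\Delta$; ($?$R) $\Gamma,\varphi\vdash\psi,\Delta\;/\;\Gamma\vdash[\varphi?]\psi,\Delta$. A GTPDL proof is a finite derivation tree built from these rules in which every leaf is an instance of (Ax) or ($\bot$). The cyclic system CGTPDL has the same rules except that ($*$R) is replaced by the case-split rule (C-s): $\Gamma\vdash\varphi,\Delta$ and $\Gamma\vdash[\pi][\pi^*]\varphi,\Delta\;/\;\Gamma\vdash[\pi^*]\varphi,\Delta$. A CGTPDL proof is a finite derivation tree, possibly with leaves that are not conclusions of a rule (buds), together with a map sending each bud to an inner node labelled by the same sequent (its companion), such that the global trace condition holds: for every infinite path in the graph obtained by identifying each bud with its companion, some tail $(\Gamma_i\vdash\Delta_i)_{i\ge k}$ of the path is followed by a trace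 with infinitely many progress points. Here a trace is a sequence of formulas $\tau_i\in\Delta_i$ such that, when the path passes from the conclusion $\Gamma_i\vdash\Delta_i$ of a rule instance to one of its assumptions $\Gamma_{i+1}\vdash\Delta_{i+1}$: for ($[\,]$) and ($[\,]^-$), $\tau_i$ is the principal formula $[\pi]\varphi$, respectively $[\pi]^-\varphi$, and $\tau_{i+1}=\varphi$; for ($\to$R), ($;$R), ($\cup$R), ($?$R), (C-s), either $\tau_{i+1}=\tau_i$, or $\tau_i$ is the principal formula and $\tau_{i+1}$ is the formula displayed for it in the consequent of that assumption; for all other rules, $\tau_{i+1}=\tau_i$. A progress point is an $i$ at which the path passes to the right assumption of (C-s), $\tau_i$ is the principal formula $[\pi^*]\varphi$ and $\tau_{i+1}=[\pi][\pi^*]\varphi$. A proof is cut-free if it has no instance of (Cut). An instance of (Cut) with conclusion $\Gamma\vdash\Delta$ is a Fischer–Ladner cut if its cut formula belongs to $\bigcup_{\varphi\in\Gamma\cup\Delta}\mathrm{FL}(\varphi)$, where $\mathrm{FL}$ and the auxiliary $\mathrm{FL}_\square$ are defined by $\mathrm{FL}(\bot)=\{\bot\}$, $\mathrm{FL}(p)=\{p\}$,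 $\mathrm{FL}(\varphi\to\psi)=\{\varphi\to\psi\}\cup\mathrm{FL}(\varphi)\cup\mathrm{FL}(\psi)$, $\mathrm{FL}([\pi]\psi)=\mathrm{FL}_\square([\pi]\psi)\cup\mathrm{FL}(\psi)$, $\mathrm{FL}([\pi]^-\psi)=\mathrm{FL}_\square([\pi]^-\psi)\cup\mathrm{FL}(\psi)$; $\mathrm{FL}_\square([\alpha]\psi)=\{[\alpha]\psi\}$, $\mathrm{FL}_\square([\pi_0;\pi_1]\psi)=\{[\pi_0;\pi_1]\psi\}\cup\mathrm{FL}_\square([\pi_0][\pi_1]\psi)\cup\mathrm{FL}_\square([\pi_1]\psi)$, $\mathrm{FL}_\square([\pi_0\cup\pi_1]\psi)=\{[\pi_0\cup\pi_1]\psi\}\cup\mathrm{FL}_\square([\pi_0]\psi)\cup\mathrm{FL}_\square([\pi_1]\psi)$, $\mathrm{FL}_\square([\pi^*]\psi)=\{[\pi^*]\psi\}\cup\mathrm{FL}_\square([\pi][\pi^*]\psi)$, $\mathrm{FL}_\square([\chi?]\psi)=\{[\chi?]\psi\}\cup\mathrm{FL}(\chi)$; and the same clauses with $[\cdot]^-$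 for $[\cdot]$, except that $\mathrm{FL}_\square([\pi_0;\pi_1]^-\psi)=\{[\pi_0;\pi_1]^-\psi\}\cup\mathrm{FL}_\square([\pi_1]^-[\pi_0]^-\psi)\cup\mathrm{FL}_\square([\pi_0]^-\psi)$. A sequent is provable, cut-free provable, or Fischer–Ladner-cut provable in a system if it has a proof, a cut-free proof, or a proof all of whose cuts are Fischer–Ladner cuts, respectively. **Theorem (failure of cut-elimination).** Let $p\in\mathsf{Prop}$ and $\alpha\in\mathsf{AtProg}$. 1. The sequent $p,[\alpha][\alpha^*]p\vdash[\alpha^*]p$ is not cut-free provable in GTPDL, and not even Fischer–Ladner-cut provable in GTPDL, but it is cut-free provable in CGTPDL. 2. The sequent $p\vdash[\alpha]\langle\alpha\rangle^-p$ is provable in GTPDL and in CGTPDL, but it is cut-free provable in neither. -/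

import Mathlib

/-! Propositional dynamic logic with backwards modalities: syntax, Fischer-Ladner closure,
sequent calculus and cyclic proof system. -/

universe u v

namespace TPDL

mutual

/-- Formulas over propositional variables `P` and atomic programs `A`.
`box π φ` is the forward modality `[π]φ`, `rbox π φ` is the backwards modality `[π]⁻φ`. -/
inductive Formula (P : Type u) (A : Type v) : Type (max u v)
  | bot : Formula P A
  | var : P → Formula P A
  | imp : Formula P A → Formula P A → Formula P A
  | box : Program P A → Formula P A → Formula P A
  | rbox : Program P A → Formula P A → Formula P A

/-- Programs: atomic programs, composition, nondeterministic choice, iteration, test. -/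
inductive Program (P : Type u) (A : Type v) : Type (max u v)
  | atom : A → Program P A
  | seq : Program P A → Program P A → Program P A
  | alt : Program P A → Program P A → Program P A
  | star : Program P A → Program P A
  | test : Formula P A → Program P A

end

variable {P : Type u} {A : Type v}

/-- Negation `¬φ` abbreviates `φ → ⊥`. -/
abbrev Formula.neg (φ : Formula P A) : Formula P A := .imp φ .bot

/-- The backwards diamond `⟨π⟩⁻φ` abbreviates `¬[π]⁻¬φ`. -/
abbrev Formula.rdia (π : Program P A) (φ : Formula P A) : Formula P A :=
  .neg (.rbox π (.neg φ))

noncomputable instance : DecidableEq (Formula P A) := Classical.decEq _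

/-! ### Fischer-Ladner closure -/

mutual

/-- The Fischer-Ladner closure of a formula. -/
def Formula.FL : Formula P A → Set (Formula P A)
  | .bot => {.bot}
  | .var p => {.var p}
  | .imp φ ψ => {.imp φ ψ} ∪ φ.FL ∪ ψ.FL
  | .box π ψ => π.FLbox ψ ∪ ψ.FL
  | .rbox π ψ => π.FLrbox ψ ∪ ψ.FL

/-- `π.FLbox ψ` is the auxiliary closure of the formula `[π]ψ`. -/
def Program.FLbox : Program P A → Formula P A → Set (Formula P A)
  | .atom a, ψ => {.box (.atom a) ψ}
  | .seq π₀ π₁, ψ => {.box (.seq π₀ π₁) ψ} ∪ π₀.FLbox (.box π₁ ψ) ∪ π₁.FLbox ψ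
  | .alt π₀ π₁, ψ => {.box (.alt π₀ π₁) ψ} ∪ π₀.FLbox ψ ∪ π₁.FLbox ψ
  | .star π, ψ => {.box (.star π) ψ} ∪ π.FLbox (.box (.star π) ψ)
  | .test χ, ψ => {.box (.test χ) ψ} ∪ χ.FL

/-- `π.FLrbox ψ` is the auxiliary closure of the formula `[π]⁻ψ`. -/
def Program.FLrbox : Program P A → Formula P A → Set (Formula P A)
  | .atom a, ψ => {.rbox (.atom a) ψ}
  | .seq π₀ π₁, ψ => {.rbox (.seq π₀ π₁) ψ} ∪ π₁.FLrbox (.rbox π₀ ψ) ∪ π₀.FLrbox ψ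
  | .alt π₀ π₁, ψ => {.rbox (.alt π₀ π₁) ψ} ∪ π₀.FLrbox ψ ∪ π₁.FLrbox ψ
  | .star π, ψ => {.rbox (.star π) ψ} ∪ π.FLrbox (.rbox (.star π) ψ)
  | .test χ, ψ => {.rbox (.test χ) ψ} ∪ χ.FL

end

/-- The Fischer-Ladner closure of a set of formulas. -/
def FLSet (Λ : Set (Formula P A)) : Set (Formula P A) := ⋃ φ ∈ Λ, φ.FL

/-! ### Sequents and rule instances -/

/-- A sequent: a pair of finite sets of formulas. -/
@[ext]
structure Sequent (P : Type u) (A : Type v) where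
  ant : Finset (Formula P A)
  con : Finset (Formula P A)

/-- Instances of the inference rules of both calculi (`starR` belongs only to the sequent
calculus, `cs` only to the cyclic system). -/
inductive Rule (P : Type u) (A : Type v) : Type (max u v)
  | ax (Γ Δ : Finset (Formula P A)) (h : (Γ ∩ Δ).Nonempty)
  | bot (Γ Δ : Finset (Formula P A))
  | impL (Γ Δ : Finset (Formula P A)) (φ ψ : Formula P A)
  | impR (Γ Δ : Finset (Formula P A)) (φ ψ : Formula P A)
  | wk (Γ Δ Γ' Δ' : Finset (Formula P A)) (hΓ : Γ ⊆ Γ') (hΔ : Δ ⊆ Δ')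
  | cut (Γ Δ : Finset (Formula P A)) (φ : Formula P A)
  | box (Γ Δ : Finset (Formula P A)) (π : Program P A) (φ : Formula P A)
  | rbox (Γ Δ : Finset (Formula P A)) (π : Program P A) (φ : Formula P A)
  | seqL (Γ Δ : Finset (Formula P A)) (π₀ π₁ : Program P A) (φ : Formula P A)
  | seqR (Γ Δ : Finset (Formula P A)) (π₀ π₁ : Program P A) (φ : Formula P A)
  | altL (Γ Δ : Finset (Formula P A)) (π₀ π₁ : Program P A) (φ : Formula P A)
  | altR (Γ Δ : Finset (Formula P A)) (π₀ π₁ : Program P A) (φ : Formula P A)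
  | starL (Γ Δ : Finset (Formula P A)) (π : Program P A) (φ : Formula P A)
  | starR (Γ : Finset (Formula P A)) (π : Program P A) (φ : Formula P A)
  | testL (Γ Δ : Finset (Formula P A)) (φ ψ : Formula P A)
  | testR (Γ Δ : Finset (Formula P A)) (φ ψ : Formula P A)
  | cs (Γ Δ : Finset (Formula P A)) (π : Program P A) (φ : Formula P A)

namespace Rule

/-- The conclusion of a rule instance. -/
noncomputable def conclusion : Rule P A → Sequent P A
  | ax Γ Δ _ => ⟨Γ, Δ⟩
  | bot Γ Δ => ⟨insert .bot Γ, Δ⟩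
  | impL Γ Δ φ ψ => ⟨insert (.imp φ ψ) Γ, Δ⟩
  | impR Γ Δ φ ψ => ⟨Γ, insert (.imp φ ψ) Δ⟩
  | wk _ _ Γ' Δ' _ _ => ⟨Γ', Δ'⟩
  | cut Γ Δ _ => ⟨Γ, Δ⟩
  | box Γ Δ π φ => ⟨Γ.image (.box π), insert (.box π φ) Δ⟩
  | rbox Γ Δ π φ => ⟨Γ.image (.rbox π), insert (.rbox π φ) Δ⟩
  | seqL Γ Δ π₀ π₁ φ => ⟨insert (.box (.seq π₀ π₁) φ) Γ, Δ⟩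
  | seqR Γ Δ π₀ π₁ φ => ⟨Γ, insert (.box (.seq π₀ π₁) φ) Δ⟩
  | altL Γ Δ π₀ π₁ φ => ⟨insert (.box (.alt π₀ π₁) φ) Γ, Δ⟩
  | altR Γ Δ π₀ π₁ φ => ⟨Γ, insert (.box (.alt π₀ π₁) φ) Δ⟩
  | starL Γ Δ π φ => ⟨insert (.box (.star π) φ) Γ, Δ⟩
  | starR Γ π φ => ⟨insert φ (Γ.image (.box (.star π))), {.box (.star π) φ}⟩
  | testL Γ Δ φ ψ => ⟨insert (.box (.test φ) ψ) Γ, Δ⟩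
  | testR Γ Δ φ ψ => ⟨Γ, insert (.box (.test φ) ψ) Δ⟩
  | cs Γ Δ π φ => ⟨Γ, insert (.box (.star π) φ) Δ⟩

/-- The list of assumptions of a rule instance, from left to right. -/
noncomputable def premises : Rule P A → List (Sequent P A)
  | ax _ _ _ => []
  | bot _ _ => []
  | impL Γ Δ φ ψ => [⟨Γ, insert φ Δ⟩, ⟨insert ψ Γ, Δ⟩]
  | impR Γ Δ φ ψ => [⟨insert φ Γ, insert ψ Δ⟩]
  | wk Γ Δ _ _ _ _ => [⟨Γ, Δ⟩]
  | cut Γ Δ φ => [⟨Γ, insert φ Δ⟩, ⟨insert φ Γ, Δ⟩]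
  | box Γ Δ π φ => [⟨Γ, insert φ (Δ.image (.rbox π))⟩]
  | rbox Γ Δ π φ => [⟨Γ, insert φ (Δ.image (.box π))⟩]
  | seqL Γ Δ π₀ π₁ φ => [⟨insert (.box π₀ (.box π₁ φ)) Γ, Δ⟩]
  | seqR Γ Δ π₀ π₁ φ => [⟨Γ, insert (.box π₀ (.box π₁ φ)) Δ⟩]
  | altL Γ Δ π₀ π₁ φ => [⟨insert (.box π₀ φ) (insert (.box π₁ φ) Γ), Δ⟩]
  | altR Γ Δ π₀ π₁ φ => [⟨Γ, insert (.box π₀ φ) Δ⟩, ⟨Γ, insert (.box π₁ φ) Δ⟩]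
  | starL Γ Δ π φ => [⟨insert φ (insert (.box π (.box (.star π) φ)) Γ), Δ⟩]
  | starR Γ π φ => [⟨insert φ Γ, {.box π φ}⟩]
  | testL Γ Δ φ ψ => [⟨Γ, insert φ Δ⟩, ⟨insert ψ Γ, Δ⟩]
  | testR Γ Δ φ ψ => [⟨insert φ Γ, insert ψ Δ⟩]
  | cs Γ Δ π φ => [⟨Γ, insert φ Δ⟩, ⟨Γ, insert (.box π (.box (.star π) φ)) Δ⟩]

/-- The rule instances of the sequent calculus GTPDL: all rules but case split. -/
def IsGTPDL : Rule P A → Prop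
  | cs _ _ _ _ => False
  | _ => True

/-- The rule instances of the cyclic system CGTPDL: all rules but the induction rule `starR`. -/
def IsCGTPDL : Rule P A → Prop
  | starR _ _ _ => False
  | _ => True

/-- The instance is not an instance of Cut. -/
def NotCut : Rule P A → Prop
  | cut _ _ _ => False
  | _ => True

/-- If the instance is a cut, then its cut formula lies in the Fischer-Ladner closure
of the set of all formulas of the conclusion of this cut. -/
def FLCut : Rule P A → Prop
  | cut Γ Δ φ => φ ∈ FLSet ((Γ : Set (Formula P A)) ∪ (Δ : Set (Formula P A)))
  | _ => True

/-- One step of a trace through a rule instance: the path passes from the conclusion to the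
assumption with index `i`, and the trace from `τ` to `τ'`. That `τ` and `τ'` belong to the
consequents of the two sequents is required separately. -/
def TraceStep : Rule P A → ℕ → Formula P A → Formula P A → Prop
  | impR _ _ φ ψ, _, τ, τ' => (τ = .imp φ ψ ∧ τ' = ψ) ∨ τ' = τ
  | box _ _ π φ, _, τ, τ' => τ = .box π φ ∧ τ' = φ
  | rbox _ _ π φ, _, τ, τ' => τ = .rbox π φ ∧ τ' = φ
  | seqR _ _ π₀ π₁ φ, _, τ, τ' =>
      (τ = .box (.seq π₀ π₁) φ ∧ τ' = .box π₀ (.box π₁ φ)) ∨ τ' = τ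
  | altR _ _ π₀ π₁ φ, i, τ, τ' =>
      (τ = .box (.alt π₀ π₁) φ ∧ τ' = .box (if i = 0 then π₀ else π₁) φ) ∨ τ' = τ
  | testR _ _ φ ψ, _, τ, τ' => (τ = .box (.test φ) ψ ∧ τ' = ψ) ∨ τ' = τ
  | cs _ _ π φ, i, τ, τ' =>
      (τ = .box (.star π) φ ∧ τ' = if i = 0 then φ else .box π (.box (.star π) φ)) ∨ τ' = τ
  | _, _, τ, τ' => τ' = τ

/-- A progressing step of a trace: the path passes through the right assumption of a case
split and the trace unfolds its principal formula. -/
def Progress : Rule P A → ℕ → Formula P A → Formula P A → Prop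
  | cs _ _ π φ, i, τ, τ' =>
      i = 1 ∧ τ = .box (.star π) φ ∧ τ' = .box π (.box (.star π) φ)
  | _, _, _, _ => False

end Rule

/-! ### Derivation trees -/

/-- Finite trees whose leaves are buds (labelled by a sequent) and whose other nodes are labelled
by rule instances, with one subtree for each assumption. -/
inductive DTree (P : Type u) (A : Type v) : Type (max u v)
  | bud (S : Sequent P A) : DTree P A
  | node (r : Rule P A) (sub : Fin r.premises.length → DTree P A) : DTree P A

namespace DTree

/-- The sequent at the root. -/
noncomputable def root : DTree P A → Sequent P A
  | bud S => S
  | node r _ => r.conclusion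

/-- `D.IsDerivation R`: `D` is a derivation tree all of whose rule instances satisfy `R`. -/
def IsDerivation (R : Rule P A → Prop) : DTree P A → Prop
  | bud _ => True
  | node r sub => R r ∧ ∀ i, (sub i).root = r.premises.get i ∧ (sub i).IsDerivation R

/-- The tree has no bud. -/
def BudFree : DTree P A → Prop
  | bud _ => False
  | node _ sub => ∀ i, (sub i).BudFree

/-- The subtree at an address (a list of child indices read from the root), if there is one. -/
noncomputable def at? : DTree P A → List ℕ → Option (DTree P A)
  | D, [] => some D
  | bud _, _ :: _ => none
  | node r sub, i :: l => if h : i < r.premises.length then (sub ⟨i, h⟩).at? l else none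

/-- `l` is the address of a bud labelled by `S`. -/
def BudAt (D : DTree P A) (l : List ℕ) (S : Sequent P A) : Prop :=
  D.at? l = some (bud S)

/-- `l` is the address of a node that is the conclusion of the rule instance `r`. -/
def RuleAt (D : DTree P A) (l : List ℕ) (r : Rule P A) : Prop :=
  ∃ sub, D.at? l = some (node r sub)

/-- `C` maps each bud of `D` to a companion of it: an inner node with the same sequent.
(The values of `C` at addresses other than those of buds are irrelevant.) -/
def IsCompanionMap (D : DTree P A) (C : List ℕ → List ℕ) : Prop :=
  ∀ l S, D.BudAt l S → ∃ r, D.RuleAt (C l) r ∧ r.premises ≠ [] ∧ r.conclusion = S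

/-- The edges of the derivation graph, obtained from `D` by identifying each bud with its
companion. `D.Edge C l r i l'`: the node `l` is the conclusion of the rule instance `r`, and its
assumption with index `i` is the node `l'` of the graph. -/
def Edge (D : DTree P A) (C : List ℕ → List ℕ) (l : List ℕ) (r : Rule P A) (i : ℕ)
    (l' : List ℕ) : Prop :=
  D.RuleAt l r ∧ i < r.premises.length ∧
    (((∃ r', D.RuleAt (l ++ [i]) r') ∧ l' = l ++ [i]) ∨
      ((∃ S, D.BudAt (l ++ [i]) S) ∧ l' = C (l ++ [i])))

/-- `(l n)` is an infinite path in the derivation graph; it uses the rule instance `r n` and its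
assumption with index `i n` at step `n`. -/
def IsPath (D : DTree P A) (C : List ℕ → List ℕ) (l : ℕ → List ℕ) (r : ℕ → Rule P A)
    (i : ℕ → ℕ) : Prop :=
  ∀ n, D.Edge C (l n) (r n) (i n) (l (n + 1))

/-- The sequence of formulas `τ` is a trace following the infinite path given by `r` and `i`. -/
def IsTrace (r : ℕ → Rule P A) (i : ℕ → ℕ) (τ : ℕ → Formula P A) : Prop :=
  ∀ n, τ n ∈ (r n).conclusion.con ∧ (r n).TraceStep (i n) (τ n) (τ (n + 1))

/-- The trace `τ` has infinitely many progress points. -/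
def InfinitelyProgressing (r : ℕ → Rule P A) (i : ℕ → ℕ) (τ : ℕ → Formula P A) : Prop :=
  ∀ m, ∃ n, m ≤ n ∧ (r n).Progress (i n) (τ n) (τ (n + 1))

/-- The global trace condition: some tail of each infinite path in the derivation graph is followed
by an infinitely progressing trace. -/
def GlobalTrace (D : DTree P A) (C : List ℕ → List ℕ) : Prop :=
  ∀ l r i, D.IsPath C l r i → ∃ (k : ℕ) (τ : ℕ → Formula P A),
    IsTrace (fun n => r (k + n)) (fun n => i (k + n)) τ ∧
      InfinitelyProgressing (fun n => r (k + n)) (fun n => i (k + n)) τ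

end DTree

/-! ### Provability -/

/-- There is a GTPDL proof of `S` (a derivation tree without buds) all of whose rule instances
satisfy `Q`. -/
def GProvableWith (Q : Rule P A → Prop) (S : Sequent P A) : Prop :=
  ∃ D : DTree P A, D.IsDerivation (fun r => r.IsGTPDL ∧ Q r) ∧ D.BudFree ∧ D.root = S

/-- There is a CGTPDL proof of `S` (a derivation tree with a companion for each bud whose
derivation graph satisfies the global trace condition) all of whose rule instances satisfy `Q`. -/
def CGProvableWith (Q : Rule P A → Prop) (S : Sequent P A) : Prop :=
  ∃ (D : DTree P A) (C : List ℕ → List ℕ), D.IsDerivation (fun r => r.IsCGTPDL ∧ Q r) ∧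
    D.IsCompanionMap C ∧ D.GlobalTrace C ∧ D.root = S

/-- Provability in GTPDL. -/
def GProvable (S : Sequent P A) : Prop := GProvableWith (fun _ => True) S

/-- Cut-free provability in GTPDL. -/
def GCutFreeProvable (S : Sequent P A) : Prop := GProvableWith Rule.NotCut S

/-- Fischer-Ladner-cut provability in GTPDL. -/
def GFLCutProvable (S : Sequent P A) : Prop := GProvableWith Rule.FLCut S

/-- Provability in CGTPDL. -/
def CGProvable (S : Sequent P A) : Prop := CGProvableWith (fun _ => True) S

/-- Cut-free provability in CGTPDL. -/
def CGCutFreeProvable (S : Sequent P A) : Prop := CGProvableWith Rule.NotCut S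

/-- The sequent `p, [α][α*]p ⊢ [α*]p`. -/
noncomputable def fixpointSequent (p : P) (a : A) : Sequent P A :=
  ⟨{.var p, .box (.atom a) (.box (.star (.atom a)) (.var p))},
    {.box (.star (.atom a)) (.var p)}⟩

/-- The sequent `p ⊢ [α]⟨α⟩⁻p`. -/
noncomputable def converseSequent (p : P) (a : A) : Sequent P A :=
  ⟨{.var p}, {.box (.atom a) (.rdia (.atom a) (.var p))}⟩

end TPDL

-- Unprovability is shown by a class `K` of sequents containing the goal and closed under backward
-- rule application: every admitted rule instance with conclusion in `K` has an assumption in `K`. A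
-- finite proof is then impossible, since its leaves have no assumptions. A cyclic proof would
-- contain an infinite path inside `K`, and such a path has no progress point if no consequent in
-- `K` contains a formula `[π*]φ`.
--
-- In both cases `K` consists of the subsequents of the goal together with sequents that fail in a
-- two-world model with one `α`-step. Failure passes backwards through every rule by local soundness
-- (`exists_fails_premise`). On subsequents very few rules apply: axioms do not, weakening stays
-- inside, and a modal or induction rule must discard the whole boxed antecedent, because its
-- outermost program does not match. The resulting assumption is then refuted in the model.
--
-- For the fixpoint sequent, Fischer–Ladner cuts change nothing: the closure contains only the three
-- formulas of the sequent, so each cut has an assumption that is again a subsequent. For the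
-- converse sequent, the failing sequents in `K` are also required to be star-free, a property that
-- all rules but cut preserve backwards; this refutes cyclic proofs too.
--
-- The positive claims need no cycles: one case split closes the fixpoint sequent by axioms, and a
-- cut on `¬p` lets the modal rule carry `p` over as `[α]⁻¬p`.

namespace TPDL

/-! ### Kripke semantics -/

/-- Kripke models over a set `W` of worlds. -/
structure Model (P : Type u) (A : Type v) (W : Type) where
  val : P → W → Prop
  acc : A → W → W → Prop

namespace Model

variable {W : Type}

mutual

/-- Truth of a formula at a world. -/
def Sat (M : Model P A W) : Formula P A → W → Prop
  | .bot, _ => False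
  | .var p, w => M.val p w
  | .imp φ ψ, w => M.Sat φ w → M.Sat ψ w
  | .box π φ, w => ∀ v, M.Rel π w v → M.Sat φ v
  | .rbox π φ, w => ∀ v, M.Rel π v w → M.Sat φ v

/-- The accessibility relation of a program. -/
def Rel (M : Model P A W) : Program P A → W → W → Prop
  | .atom a, w, v => M.acc a w v
  | .seq π₀ π₁, w, v => ∃ x, M.Rel π₀ w x ∧ M.Rel π₁ x v
  | .alt π₀ π₁, w, v => M.Rel π₀ w v ∨ M.Rel π₁ w v
  | .star π, w, v => Relation.ReflTransGen (M.Rel π) w v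
  | .test φ, w, v => w = v ∧ M.Sat φ w

end

/-- The sequent `S` fails at the world `w`. -/
def Fails (M : Model P A W) (S : Sequent P A) (w : W) : Prop :=
  (∀ φ ∈ S.ant, M.Sat φ w) ∧ ∀ φ ∈ S.con, ¬ M.Sat φ w

/-- Local soundness: if the conclusion of a rule instance fails somewhere in a model, then so does
one of its assumptions. -/
theorem exists_fails_premise (M : Model P A W) (r : Rule P A) (w : W)
    (h : M.Fails r.conclusion w) : ∃ S ∈ r.premises, ∃ v, M.Fails S v := by
  obtain ⟨hl, hr⟩ := h
  cases r with
  | ax Γ Δ h =>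
    obtain ⟨φ, hφ⟩ := h
    rw [Finset.mem_inter] at hφ
    exact absurd (hl φ hφ.1) (hr φ hφ.2)
  | bot Γ Δ => exact (hl .bot (Finset.mem_insert_self _ _)).elim
  | impL Γ Δ φ ψ =>
    simp only [Rule.conclusion, Finset.forall_mem_insert, Sat] at hl hr
    by_cases hφ : M.Sat φ w
    · exact ⟨_, .tail _ (.head _), w, by simpa [Fails] using ⟨⟨hl.1 hφ, hl.2⟩, hr⟩⟩
    · exact ⟨_, .head _, w, by simpa [Fails] using ⟨hl.2, hφ, hr⟩⟩
  | impR Γ Δ φ ψ =>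
    simp only [Rule.conclusion, Finset.forall_mem_insert, Sat, Classical.not_imp] at hl hr
    exact ⟨_, .head _, w, by simpa [Fails] using ⟨⟨hr.1.1, hl⟩, hr.1.2, hr.2⟩⟩
  | wk Γ Δ Γ' Δ' hΓ hΔ =>
    exact ⟨_, .head _, w, fun φ hφ => hl φ (hΓ hφ), fun φ hφ => hr φ (hΔ hφ)⟩
  | cut Γ Δ φ =>
    simp only [Rule.conclusion] at hl hr
    by_cases hφ : M.Sat φ w
    · exact ⟨_, .tail _ (.head _), w, by simpa [Fails] using ⟨⟨hφ, hl⟩, hr⟩⟩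
    · exact ⟨_, .head _, w, by simpa [Fails] using ⟨hl, hφ, hr⟩⟩
  | box Γ Δ π φ =>
    simp only [Rule.conclusion, Finset.forall_mem_insert, Finset.forall_mem_image, Sat,
      not_forall] at hl hr
    obtain ⟨⟨v, hv, hφ⟩, hΔ⟩ := hr
    -- The assumption fails at the successor `v`: each `[π]⁻ψ` with `ψ ∈ Δ` is false there because
    -- `w` is a predecessor of `v` falsifying `ψ`.
    refine ⟨_, .head _, v, fun ψ hψ => hl hψ v hv, ?_⟩
    simp only [Finset.forall_mem_insert, Finset.forall_mem_image, Sat]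
    exact ⟨hφ, fun ψ hψ h => hΔ ψ hψ (h w hv)⟩
  | rbox Γ Δ π φ =>
    simp only [Rule.conclusion, Finset.forall_mem_insert, Finset.forall_mem_image, Sat,
      not_forall] at hl hr
    obtain ⟨⟨v, hv, hφ⟩, hΔ⟩ := hr
    refine ⟨_, .head _, v, fun ψ hψ => hl hψ v hv, ?_⟩
    simp only [Finset.forall_mem_insert, Finset.forall_mem_image, Sat]
    exact ⟨hφ, fun ψ hψ h => hΔ ψ hψ (h w hv)⟩
  | seqL Γ Δ π₀ π₁ φ =>
    simp only [Rule.conclusion, Finset.forall_mem_insert, Sat, Rel] at hl hr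
    refine ⟨_, .head _, w, ?_, hr⟩
    simp only [Finset.forall_mem_insert, Sat]
    exact ⟨fun x hx v hv => hl.1 v ⟨x, hx, hv⟩, hl.2⟩
  | seqR Γ Δ π₀ π₁ φ =>
    simp only [Rule.conclusion, Finset.forall_mem_insert, Sat, Rel] at hl hr
    refine ⟨_, .head _, w, hl, ?_⟩
    simp only [Finset.forall_mem_insert, Sat]
    exact ⟨fun h => hr.1 fun v ⟨x, hx, hv⟩ => h x hx v hv, hr.2⟩
  | altL Γ Δ π₀ π₁ φ =>
    simp only [Rule.conclusion, Finset.forall_mem_insert, Sat, Rel] at hl hr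
    refine ⟨_, .head _, w, ?_, hr⟩
    simp only [Finset.forall_mem_insert, Sat]
    exact ⟨fun v hv => hl.1 v (.inl hv), fun v hv => hl.1 v (.inr hv), hl.2⟩
  | altR Γ Δ π₀ π₁ φ =>
    simp only [Rule.conclusion, Finset.forall_mem_insert, Sat, Rel] at hl hr
    by_cases h₀ : M.Sat (.box π₀ φ) w
    · refine ⟨_, .tail _ (.head _), w, hl, ?_⟩
      simp only [Finset.forall_mem_insert, Sat] at h₀ ⊢
      exact ⟨fun h₁ => hr.1 fun v hv => hv.elim (h₀ v) (h₁ v), hr.2⟩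
    · exact ⟨_, .head _, w, hl, Finset.forall_mem_insert .. |>.2 ⟨h₀, hr.2⟩⟩
  | starL Γ Δ π φ =>
    simp only [Rule.conclusion, Finset.forall_mem_insert, Sat, Rel] at hl hr
    refine ⟨_, .head _, w, ?_, hr⟩
    simp only [Finset.forall_mem_insert, Sat, Rel]
    exact ⟨hl.1 w .refl, fun x hx v hv => hl.1 v (.head hx hv), hl.2⟩
  | starR Γ π φ =>
    simp only [Rule.conclusion, Finset.forall_mem_insert, Finset.forall_mem_image,
      Finset.mem_singleton, forall_eq, Sat, Rel, not_forall] at hl hr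
    obtain ⟨hφ, hΓ⟩ := hl
    obtain ⟨v, hv, hφv⟩ := hr
    -- If the assumption failed nowhere, `φ` would propagate along every `π`-step of the path from
    -- `w` to `v`.
    by_contra hS
    refine hφv ?_
    clear hφv
    induction hv with
    | refl => exact hφ
    | @tail x y hx hxy ih =>
      by_contra hy
      refine hS ⟨_, .head _, x, ?_, ?_⟩
      · exact Finset.forall_mem_insert .. |>.2 ⟨ih, fun ψ hψ => hΓ hψ x hx⟩
      · simp only [Finset.mem_singleton, forall_eq, Sat]
        exact fun h => hy (h y hxy)
  | testL Γ Δ φ ψ =>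
    simp only [Rule.conclusion, Finset.forall_mem_insert, Sat, Rel] at hl hr
    by_cases hφ : M.Sat φ w
    · exact ⟨_, .tail _ (.head _), w, Finset.forall_mem_insert .. |>.2
        ⟨hl.1 w ⟨rfl, hφ⟩, hl.2⟩, hr⟩
    · exact ⟨_, .head _, w, hl.2, Finset.forall_mem_insert .. |>.2 ⟨hφ, hr⟩⟩
  | testR Γ Δ φ ψ =>
    simp only [Rule.conclusion, Finset.forall_mem_insert, Sat, Rel, not_forall] at hl hr
    obtain ⟨⟨v, ⟨rfl, hφ⟩, hψ⟩, hΔ⟩ := hr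
    exact ⟨_, .head _, w, Finset.forall_mem_insert .. |>.2 ⟨hφ, hl⟩,
      Finset.forall_mem_insert .. |>.2 ⟨hψ, hΔ⟩⟩
  | cs Γ Δ π φ =>
    simp only [Rule.conclusion, Finset.forall_mem_insert, Sat, Rel] at hl hr
    by_cases hφ : M.Sat φ w
    · refine ⟨_, .tail _ (.head _), w, hl, ?_⟩
      simp only [Finset.forall_mem_insert, Sat, Rel]
      refine ⟨fun h => hr.1 fun v hv => ?_, hr.2⟩
      rcases hv.cases_head with rfl | ⟨x, hx, hxv⟩
      · exact hφ
      · exact h x hx v hxv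
    · exact ⟨_, .head _, w, hl, Finset.forall_mem_insert .. |>.2 ⟨hφ, hr.2⟩⟩

end Model

/-! ### Unprovability from classes of sequents closed under backwards rule application -/

/-- Every rule instance satisfying `R` with conclusion in `K` has an assumption in `K`. -/
def BackwardClosed (R : Rule P A → Prop) (K : Sequent P A → Prop) : Prop :=
  ∀ r : Rule P A, R r → K r.conclusion → ∃ S ∈ r.premises, K S

/-- Climbing from the root inside `K` never stops, while a finite bud-free tree ends in rules
without assumptions. -/
theorem BackwardClosed.not_budFree {R : Rule P A → Prop} {K : Sequent P A → Prop}
    (hK : BackwardClosed R K) (D : DTree P A) (hD : D.IsDerivation R) (hB : D.BudFree) :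
    ¬ K D.root := by
  induction D with
  | bud S => exact hB.elim
  | node r sub ih =>
    intro h
    obtain ⟨S, hS, hKS⟩ := hK r hD.1 h
    obtain ⟨i, rfl⟩ := List.mem_iff_get.1 hS
    obtain ⟨hi, hd⟩ := hD.2 i
    exact ih i hd (hB i) (hi ▸ hKS)

theorem BackwardClosed.not_gProvableWith {Q : Rule P A → Prop} {K : Sequent P A → Prop}
    (hK : BackwardClosed (fun r => r.IsGTPDL ∧ Q r) K) {S : Sequent P A} (hS : K S) :
    ¬ GProvableWith Q S := by
  rintro ⟨D, hD, hB, rfl⟩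
  exact hK.not_budFree D hD hB hS

-- Infinite paths in cyclic proofs

namespace DTree

theorem at?_append (D : DTree P A) (l m : List ℕ) :
    D.at? (l ++ m) = (D.at? l).bind fun E => E.at? m := by
  induction l generalizing D with
  | nil => simp [at?]
  | cons i l ih =>
    cases D with
    | bud S => simp [at?]
    | node r sub =>
      simp only [List.cons_append, at?]
      split
      · exact ih _
      · rfl

theorem IsDerivation.at? {R : Rule P A → Prop} {D E : DTree P A} (hD : D.IsDerivation R)
    {l : List ℕ} (h : D.at? l = some E) : E.IsDerivation R := by
  induction l generalizing D with
  | nil =>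
    simp only [DTree.at?, Option.some.injEq] at h
    exact h ▸ hD
  | cons i l ih =>
    cases D with
    | bud S => simp [DTree.at?] at h
    | node r sub =>
      simp only [DTree.at?] at h
      split at h
      · exact ih (hD.2 _).2 h
      · cases h

/-- From a rule instance with conclusion in a backward closed class, the derivation graph has an
edge to another one. -/
theorem exists_edge {R : Rule P A → Prop} {K : Sequent P A → Prop} (hK : BackwardClosed R K)
    {D : DTree P A} {C : List ℕ → List ℕ} (hD : D.IsDerivation R) (hC : D.IsCompanionMap C)
    {l : List ℕ} {r : Rule P A} (hl : D.RuleAt l r) (hr : K r.conclusion) :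
    ∃ i l' r', D.Edge C l r i l' ∧ D.RuleAt l' r' ∧ K r'.conclusion := by
  obtain ⟨sub, hsub⟩ := hl
  have hN := hD.at? hsub
  obtain ⟨S, hS, hKS⟩ := hK r hN.1 hr
  obtain ⟨i, rfl⟩ := List.mem_iff_get.1 hS
  have hi : D.at? (l ++ [i.1]) = some (sub i) := by
    simp [at?_append, hsub, at?]
  obtain ⟨hroot, -⟩ := hN.2 i
  cases hE : sub i with
  | bud T =>
    rw [hE] at hi hroot
    obtain ⟨r', hr', -, hc⟩ := hC _ _ hi
    refine ⟨i, C (l ++ [i.1]), r', ⟨⟨sub, hsub⟩, i.2, .inr ⟨⟨T, hi⟩, rfl⟩⟩, hr', ?_⟩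
    rw [hc]
    exact hroot.symm.subst (motive := K) hKS
  | node r' sub' =>
    rw [hE] at hi hroot
    exact ⟨i, l ++ [i.1], r', ⟨⟨sub, hsub⟩, i.2, .inl ⟨⟨r', sub', hi⟩, rfl⟩⟩, ⟨sub', hi⟩,
      hroot.symm.subst (motive := K) hKS⟩

/-- From a rule instance with conclusion in a backward closed class, there is an infinite path
through that class in the derivation graph. -/
theorem exists_isPath {R : Rule P A → Prop} {K : Sequent P A → Prop} (hK : BackwardClosed R K)
    {D : DTree P A} {C : List ℕ → List ℕ} (hD : D.IsDerivation R) (hC : D.IsCompanionMap C)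
    {l : List ℕ} {r : Rule P A} (hl : D.RuleAt l r) (hr : K r.conclusion) :
    ∃ l r i, D.IsPath C l r i ∧ ∀ n, K (r n).conclusion := by
  let N := { x : List ℕ × Rule P A // D.RuleAt x.1 x.2 ∧ K x.2.conclusion }
  have step : ∀ x : N, ∃ (i : ℕ) (y : N), D.Edge C x.1.1 x.1.2 i y.1.1 := fun x => by
    obtain ⟨i, l', r', he, h⟩ := exists_edge hK hD hC x.2.1 x.2.2
    exact ⟨i, ⟨(l', r'), h⟩, he⟩
  choose idx next hnext using step
  let x : ℕ → N := fun n => next^[n] ⟨(l, r), hl, hr⟩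
  refine ⟨fun n => (x n).1.1, fun n => (x n).1.2, fun n => idx (x n), fun n => ?_,
    fun n => (x n).2.2⟩
  have hx : x (n + 1) = next (x n) := Function.iterate_succ_apply' ..
  simp only [hx]
  exact hnext (x n)

end DTree

/-- Progress occurs only at a case split whose principal formula `[π*]φ` is the current trace
formula, hence lies in the consequent. On an infinite path inside `K` this is excluded by `hstar`,
so the global trace condition fails. -/
theorem BackwardClosed.not_cgProvableWith {Q : Rule P A → Prop} {K : Sequent P A → Prop}
    (hK : BackwardClosed (fun r => r.IsCGTPDL ∧ Q r) K)
    (hstar : ∀ S, K S → ∀ π φ, Formula.box (.star π) φ ∉ S.con)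
    {S : Sequent P A} (hS : K S) : ¬ CGProvableWith Q S := by
  rintro ⟨D, C, hD, hC, hG, rfl⟩
  obtain ⟨l, r, hl, hr⟩ : ∃ l r, D.RuleAt l r ∧ K r.conclusion := by
    cases D with
    | bud S =>
      obtain ⟨r, hr, -, hc⟩ := hC [] S rfl
      exact ⟨_, r, hr, hc ▸ hS⟩
    | node r sub => exact ⟨[], r, ⟨sub, rfl⟩, hS⟩
  obtain ⟨l, r, i, hp, hKr⟩ := DTree.exists_isPath hK hD hC hl hr
  obtain ⟨k, τ, hτ, hprog⟩ := hG l r i hp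
  obtain ⟨n, -, hn⟩ := hprog 0
  have hmem := (hτ n).1
  have hKn := hstar _ (hKr (k + n))
  dsimp only at hn hmem
  generalize r (k + n) = r' at *
  cases r' with
  | cs Γ Δ π φ => exact hKn π φ (hn.2.1 ▸ hmem)
  | _ => exact hn

/-! ### Star-free formulas -/

mutual

/-- No iteration occurs in the formula. -/
def Formula.StarFree : Formula P A → Prop
  | .bot => True
  | .var _ => True
  | .imp φ ψ => φ.StarFree ∧ ψ.StarFree
  | .box π φ => π.StarFree ∧ φ.StarFree
  | .rbox π φ => π.StarFree ∧ φ.StarFree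

/-- No iteration occurs in the program. -/
def Program.StarFree : Program P A → Prop
  | .atom _ => True
  | .seq π₀ π₁ => π₀.StarFree ∧ π₁.StarFree
  | .alt π₀ π₁ => π₀.StarFree ∧ π₁.StarFree
  | .star _ => False
  | .test φ => φ.StarFree

end

/-- All formulas of the sequent are star-free. -/
def Sequent.StarFree (S : Sequent P A) : Prop :=
  (∀ φ ∈ S.ant, φ.StarFree) ∧ ∀ φ ∈ S.con, φ.StarFree

/-- Without cut, every program and formula of an assumption already occurs in the conclusion. In the
modal rules, the programs prefixed to `Δ` come from the principal formula; the star rules have no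
star-free conclusion. -/
theorem Rule.starFree_premise {r : Rule P A} (hr : r.NotCut) (h : r.conclusion.StarFree)
    {S : Sequent P A} (hS : S ∈ r.premises) : S.StarFree := by
  cases r with
  | cut => exact hr.elim
  | wk Γ Δ Γ' Δ' hΓ hΔ =>
    simp only [premises, List.mem_singleton] at hS
    subst hS
    exact ⟨fun φ hφ => h.1 φ (hΓ hφ), fun φ hφ => h.2 φ (hΔ hφ)⟩
  | box Γ Δ π φ =>
    simp only [premises, List.mem_singleton] at hS
    subst hS
    simp only [Rule.conclusion, Sequent.StarFree, Finset.forall_mem_insert,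
      Finset.forall_mem_image, Formula.StarFree] at h ⊢
    exact ⟨fun ψ hψ => (h.1 hψ).2, h.2.1.2, fun ψ hψ => ⟨h.2.1.1, h.2.2 ψ hψ⟩⟩
  | rbox Γ Δ π φ =>
    simp only [premises, List.mem_singleton] at hS
    subst hS
    simp only [Rule.conclusion, Sequent.StarFree, Finset.forall_mem_insert,
      Finset.forall_mem_image, Formula.StarFree] at h ⊢
    exact ⟨fun ψ hψ => (h.1 hψ).2, h.2.1.2, fun ψ hψ => ⟨h.2.1.1, h.2.2 ψ hψ⟩⟩
  | ax | bot => simp [premises] at hS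
  | starR | starL | cs =>
    simp [Rule.conclusion, Sequent.StarFree, Formula.StarFree, Program.StarFree] at h
  | _ =>
    simp only [premises, List.mem_cons, List.not_mem_nil, or_false] at hS
    simp only [Rule.conclusion, Sequent.StarFree, Finset.forall_mem_insert,
      Formula.StarFree, Program.StarFree] at h
    try rcases hS with rfl | rfl
    all_goals
      simp only [Sequent.StarFree, Finset.forall_mem_insert, Formula.StarFree]
      tauto

/-! ### Unprovability of the fixpoint sequent with Fischer-Ladner cuts -/

/-- Two worlds, with a transition for every atomic program from `true` to `false`; every variable
holds exactly at the worlds where `V` does. -/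
def twoWorld (V : Bool → Prop) : Model P A Bool where
  val _ w := V w
  acc _ w v := w = true ∧ v = false

theorem Rule.FLCut.of_notCut {r : Rule P A} (h : r.NotCut) : r.FLCut := by
  cases r <;> trivial

theorem GCutFreeProvable.gflCutProvable {S : Sequent P A} (h : GCutFreeProvable S) :
    GFLCutProvable S := by
  obtain ⟨D, hD, hB, rfl⟩ := h
  refine ⟨D, ?_, hB, rfl⟩
  clear hB
  induction D with
  | bud S => trivial
  | node r sub ih =>
    exact ⟨⟨hD.1.1, .of_notCut hD.1.2⟩, fun i => ⟨(hD.2 i).1, ih i (hD.2 i).2⟩⟩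

/-- The three formulas `p`, `[α][α*]p`, `[α*]p` form a Fischer–Ladner closed set. -/
theorem FLSet_subset_of_fixpoint {p : P} {a : A} {S : Sequent P A}
    (hl : S.ant ⊆ (fixpointSequent p a).ant) (hr : S.con ⊆ (fixpointSequent p a).con) :
    FLSet ((S.ant : Set (Formula P A)) ∪ S.con) ⊆
      (fixpointSequent p a).ant ∪ (fixpointSequent p a).con := by
  intro ψ hψ
  simp only [FLSet, Set.mem_iUnion, Set.mem_union, Finset.mem_coe] at hψ
  obtain ⟨φ, hφ, hψ⟩ := hψ
  have : φ ∈ (fixpointSequent p a).ant ∨ φ ∈ (fixpointSequent p a).con :=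
    hφ.imp (fun h => hl h) (fun h => hr h)
  simp only [fixpointSequent, Finset.mem_insert, Finset.mem_singleton] at this
  rcases this with (rfl | rfl) | rfl <;>
    simp only [Formula.FL, Program.FLbox, Set.mem_union, Set.mem_singleton_iff] at hψ <;>
    simp [fixpointSequent] <;> tauto

theorem fixpoint_backwardClosed (p : P) (a : A) :
    BackwardClosed (fun r => r.IsGTPDL ∧ r.FLCut) fun S : Sequent P A =>
      (S.ant ⊆ (fixpointSequent p a).ant ∧ S.con ⊆ (fixpointSequent p a).con) ∨
        ∃ w, (twoWorld (· = true)).Fails S w := by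
  rintro r ⟨hG, hFL⟩ (⟨hl, hr⟩ | ⟨w, hw⟩)
  swap
  · obtain ⟨S, hS, h⟩ := Model.exists_fails_premise _ r w hw
    exact ⟨S, hS, .inr h⟩
  cases r with
  | cs => exact hG.elim
  | ax Γ Δ h =>
    obtain ⟨φ, hφ⟩ := h
    rw [Finset.mem_inter] at hφ
    have h₁ := hl hφ.1
    have h₂ := hr hφ.2
    simp only [fixpointSequent, Finset.mem_insert, Finset.mem_singleton] at h₁ h₂
    subst h₂
    simp at h₁
  | wk Γ Δ Γ' Δ' hΓ hΔ =>
    exact ⟨_, .head _, .inl ⟨hΓ.trans hl, hΔ.trans hr⟩⟩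
  | cut Γ Δ φ =>
    rcases FLSet_subset_of_fixpoint (S := ⟨Γ, Δ⟩) hl hr hFL with h | h
    -- The cut formula already belongs to one side of the goal; the assumption adding it to that
    -- side is again a subsequent.
    · exact ⟨_, .tail _ (.head _), .inl ⟨Finset.insert_subset h hl, hr⟩⟩
    · exact ⟨_, .head _, .inl ⟨hl, Finset.insert_subset h hr⟩⟩
  | box Γ Δ π φ =>
    simp only [Rule.conclusion, fixpointSequent, Finset.insert_subset_iff,
      Finset.mem_singleton, Formula.box.injEq] at hl hr
    obtain ⟨⟨rfl, rfl⟩, hΔ⟩ := hr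
    -- Here `π` is `α*`, and neither `p` nor `[α][α*]p` has the form `[α*]ψ`.
    have hΓ : ∀ ψ, ψ ∉ Γ := fun ψ hψ => by
      simpa using hl (Finset.mem_image_of_mem _ hψ)
    refine ⟨_, .head _, .inr ⟨false, fun ψ hψ => (hΓ ψ hψ).elim, ?_⟩⟩
    simp only [Finset.forall_mem_insert, Finset.forall_mem_image, Model.Sat, Model.Rel]
    refine ⟨by simp [twoWorld], fun ψ hψ h => ?_⟩
    have := h false .refl
    rw [Finset.mem_singleton.1 (hΔ hψ)] at this
    simpa [twoWorld, Model.Sat] using this false .refl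
  | starR Γ π φ =>
    simp only [Rule.conclusion, fixpointSequent, Finset.singleton_subset_iff,
      Finset.mem_singleton, Formula.box.injEq, Program.star.injEq] at hl hr
    obtain ⟨rfl, rfl⟩ := hr
    have hΓ : ∀ ψ, ψ ∉ Γ := fun ψ hψ => by
      simpa using hl (Finset.mem_insert_of_mem (Finset.mem_image_of_mem _ hψ))
    -- The assumption is `p ⊢ [α]p`, refuted at `true`, whose successor `false` falsifies `p`.
    refine ⟨_, .head _, .inr ⟨true, ?_, ?_⟩⟩
    · exact Finset.forall_mem_insert .. |>.2
        ⟨by simp [twoWorld, Model.Sat], fun ψ hψ => (hΓ ψ hψ).elim⟩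
    · simp [twoWorld, Model.Sat, Model.Rel]
  | _ =>
    simp only [Rule.conclusion, fixpointSequent, Finset.insert_subset_iff, Finset.mem_insert,
      Finset.mem_singleton, Formula.box.injEq, reduceCtorEq, false_and, or_false] at hl hr

theorem not_gflCutProvable_fixpointSequent (p : P) (a : A) :
    ¬ GFLCutProvable (fixpointSequent p a) :=
  (fixpoint_backwardClosed p a).not_gProvableWith (.inl ⟨subset_rfl, subset_rfl⟩)

/-! ### Unprovability of the converse sequent without cuts -/

theorem converse_backwardClosed (p : P) (a : A) :
    BackwardClosed Rule.NotCut fun S : Sequent P A =>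
      (S.ant ⊆ (converseSequent p a).ant ∧ S.con ⊆ (converseSequent p a).con) ∨
        S.StarFree ∧ ∃ w, (twoWorld fun _ => False).Fails S w := by
  rintro r hC (⟨hl, hr⟩ | ⟨hs, w, hw⟩)
  swap
  · obtain ⟨S, hS, h⟩ := Model.exists_fails_premise _ r w hw
    exact ⟨S, hS, .inr ⟨r.starFree_premise hC hs hS, h⟩⟩
  cases r with
  | cut => exact hC.elim
  | ax Γ Δ h =>
    obtain ⟨φ, hφ⟩ := h
    rw [Finset.mem_inter] at hφ
    have h₁ := hl hφ.1
    have h₂ := hr hφ.2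
    simp only [converseSequent, Finset.mem_singleton] at h₁ h₂
    subst h₂
    simp at h₁
  | wk Γ Δ Γ' Δ' hΓ hΔ =>
    exact ⟨_, .head _, .inl ⟨hΓ.trans hl, hΔ.trans hr⟩⟩
  | box Γ Δ π φ =>
    simp only [Rule.conclusion, converseSequent, Finset.insert_subset_iff,
      Finset.mem_singleton, Formula.box.injEq] at hl hr
    obtain ⟨⟨rfl, rfl⟩, hΔ⟩ := hr
    have hΓ : ∀ ψ, ψ ∉ Γ := fun ψ hψ => by
      simpa using hl (Finset.mem_image_of_mem _ hψ)
    -- The world `false` has the predecessor `true`, and `p` holds nowhere: this falsifies `⟨α⟩⁻p`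
    -- at `false`, hence `[α]⟨α⟩⁻p` at `true` and `[α]⁻[α]⟨α⟩⁻p` at `false`.
    refine ⟨_, .head _, .inr ⟨⟨fun ψ hψ => (hΓ ψ hψ).elim, ?_⟩, false,
      fun ψ hψ => (hΓ ψ hψ).elim, ?_⟩⟩
    · simp only [Finset.forall_mem_insert, Finset.forall_mem_image]
      refine ⟨by simp [Formula.StarFree, Program.StarFree], fun ψ hψ => ?_⟩
      rw [Finset.mem_singleton.1 (hΔ hψ)]
      simp [Formula.StarFree, Program.StarFree]
    · simp only [Finset.forall_mem_insert, Finset.forall_mem_image]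
      refine ⟨by simp [twoWorld, Model.Sat, Model.Rel], fun ψ hψ => ?_⟩
      rw [Finset.mem_singleton.1 (hΔ hψ)]
      simp [twoWorld, Model.Sat, Model.Rel]
  | _ =>
    simp only [Rule.conclusion, converseSequent, Finset.insert_subset_iff,
      Finset.singleton_subset_iff, Finset.mem_singleton, Formula.box.injEq, reduceCtorEq,
      false_and] at hl hr

theorem BackwardClosed.mono {R R' : Rule P A → Prop} {K : Sequent P A → Prop}
    (hK : BackwardClosed R K) (h : ∀ r, R' r → R r) : BackwardClosed R' K :=
  fun r hr => hK r (h r hr)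

theorem not_gCutFreeProvable_converseSequent (p : P) (a : A) :
    ¬ GCutFreeProvable (converseSequent p a) :=
  ((converse_backwardClosed p a).mono fun _ h => h.2).not_gProvableWith
    (.inl ⟨subset_rfl, subset_rfl⟩)

theorem not_cgCutFreeProvable_converseSequent (p : P) (a : A) :
    ¬ CGCutFreeProvable (converseSequent p a) := by
  refine ((converse_backwardClosed p a).mono fun _ h => h.2).not_cgProvableWith ?_
    (.inl ⟨subset_rfl, subset_rfl⟩)
  rintro S (⟨-, hr⟩ | ⟨hs, -⟩) π φ h
  · simpa [converseSequent] using hr h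
  · exact (hs.2 _ h).1

/-! ### Bud-free derivations -/

/-- Derivability by a finite tree without buds. -/
inductive Derivable (R : Rule P A → Prop) : Sequent P A → Prop
  | intro (r : Rule P A) (hr : R r) (h : ∀ S ∈ r.premises, Derivable R S) :
      Derivable R r.conclusion

theorem Derivable.of_rule {R : Rule P A → Prop} {S : Sequent P A} (r : Rule P A)
    (hS : r.conclusion = S) (hr : R r) (h : ∀ T ∈ r.premises, Derivable R T) : Derivable R S :=
  hS ▸ .intro r hr h

theorem Derivable.of_mem {R : Rule P A → Prop} (hR : ∀ Γ Δ h, R (.ax Γ Δ h))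
    {Γ Δ : Finset (Formula P A)} {φ : Formula P A} (hl : φ ∈ Γ) (hr : φ ∈ Δ) :
    Derivable R ⟨Γ, Δ⟩ :=
  .intro (.ax Γ Δ ⟨φ, Finset.mem_inter.2 ⟨hl, hr⟩⟩) (hR _ _ _) (by simp [Rule.premises])

theorem Derivable.exists_tree {R : Rule P A → Prop} {S : Sequent P A} (h : Derivable R S) :
    ∃ D : DTree P A, D.IsDerivation R ∧ D.BudFree ∧ D.root = S := by
  induction h with
  | intro r hr h ih =>
    choose sub hsub using fun i : Fin r.premises.length => ih _ (List.get_mem r.premises i)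
    exact ⟨.node r sub, ⟨hr, fun i => ⟨(hsub i).2.2, (hsub i).1⟩⟩, fun i => (hsub i).2.1, rfl⟩

namespace DTree

theorem BudFree.not_budAt {D : DTree P A} (hD : D.BudFree) (l : List ℕ) (S : Sequent P A) :
    ¬ D.BudAt l S := by
  induction l generalizing D with
  | nil =>
    intro h
    simp only [BudAt, at?, Option.some.injEq] at h
    exact (h ▸ hD : (bud S).BudFree)
  | cons i l ih =>
    cases D with
    | bud => exact hD.elim
    | node r sub =>
      simp only [BudAt, at?]
      split
      · exact ih (hD _)
      · simp

theorem exists_length_bound (D : DTree P A) :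
    ∃ N, ∀ l E, D.at? l = some E → l.length ≤ N := by
  induction D with
  | bud S =>
    refine ⟨0, fun l E h => ?_⟩
    cases l with
    | nil => simp
    | cons => simp [at?] at h
  | node r sub ih =>
    choose N hN using ih
    refine ⟨(Finset.univ.sup N) + 1, fun l E h => ?_⟩
    cases l with
    | nil => simp
    | cons i l =>
      simp only [at?] at h
      split at h
      · have := (hN _ l E h).trans (Finset.le_sup (f := N) (Finset.mem_univ _))
        simpa using this
      · cases h

/-- Vacuous: without buds a path descends at every step, which the bounded depth forbids. -/
theorem BudFree.globalTrace {D : DTree P A} (hD : D.BudFree) (C : List ℕ → List ℕ) :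
    D.GlobalTrace C := by
  intro l r i hp
  obtain ⟨N, hN⟩ := D.exists_length_bound
  have hlen : ∀ n, n ≤ (l n).length := fun n => by
    induction n with
    | zero => simp
    | succ n ih =>
      rcases (hp n).2.2 with ⟨-, h⟩ | ⟨⟨S, h⟩, -⟩
      · rw [h]
        simpa using ih
      · exact (hD.not_budAt _ _ h).elim
  obtain ⟨sub, hsub⟩ := (hp (N + 1)).1
  have := (hlen (N + 1)).trans (hN _ _ hsub)
  omega

end DTree

theorem Derivable.gProvableWith {Q : Rule P A → Prop} {S : Sequent P A}
    (h : Derivable (fun r => r.IsGTPDL ∧ Q r) S) : GProvableWith Q S :=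
  h.exists_tree

theorem Derivable.cgProvableWith {Q : Rule P A → Prop} {S : Sequent P A}
    (h : Derivable (fun r => r.IsCGTPDL ∧ Q r) S) : CGProvableWith Q S := by
  obtain ⟨D, hD, hB, hS⟩ := h.exists_tree
  exact ⟨D, id, hD, fun l S h => (hB.not_budAt l S h).elim, hB.globalTrace _, hS⟩

-- Derivations of the two sequents

theorem cgCutFreeProvable_fixpointSequent (p : P) (a : A) :
    CGCutFreeProvable (fixpointSequent p a) := by
  refine Derivable.cgProvableWith ?_
  refine .of_rule (.cs {.var p, .box (.atom a) (.box (.star (.atom a)) (.var p))} ∅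
    (.atom a) (.var p)) (by simp [Rule.conclusion, fixpointSequent]) ⟨trivial, trivial⟩ ?_
  simp only [Rule.premises, List.forall_mem_cons, List.not_mem_nil, false_imp_iff, implies_true,
    and_true]
  constructor
  · exact .of_mem (φ := .var p) (fun _ _ _ => ⟨trivial, trivial⟩) (by simp) (by simp)
  · exact .of_mem (φ := .box (.atom a) (.box (.star (.atom a)) (.var p)))
      (fun _ _ _ => ⟨trivial, trivial⟩) (by simp) (by simp)

/-- The converse sequent is derivable by a cut on `¬p`, without induction or case split. -/
theorem derivable_converseSequent (p : P) (a : A) :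
    Derivable (fun r => r.IsGTPDL ∧ r.IsCGTPDL) (converseSequent p a) := by
  refine .of_rule (.cut _ _ (.neg (.var p))) rfl ⟨trivial, trivial⟩ ?_
  simp only [Rule.premises, List.forall_mem_cons, List.not_mem_nil, false_imp_iff, implies_true,
    and_true]
  constructor
  -- Weakening drops `p`, which is not of the form `[α]ψ` and would block the modal rule; its
  -- information survives as `¬p` on the right.
  · refine .of_rule (.wk ∅ (insert (.box (.atom a) (.rdia (.atom a) (.var p))) {.neg (.var p)}) _ _
      (by simp) (by rw [Finset.pair_comm])) rfl ⟨trivial, trivial⟩ ?_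
    simp only [Rule.premises, List.forall_mem_singleton]
    refine .of_rule (.box ∅ {.neg (.var p)} (.atom a) (.rdia (.atom a) (.var p)))
      (by simp [Rule.conclusion]) ⟨trivial, trivial⟩ ?_
    simp only [Rule.premises, List.forall_mem_singleton]
    refine .of_rule (.impR ∅ _ _ _) rfl ⟨trivial, trivial⟩ ?_
    simp only [Rule.premises, List.forall_mem_singleton]
    exact .of_mem (φ := .rbox (.atom a) (.neg (.var p))) (fun _ _ _ => ⟨trivial, trivial⟩)
      (by simp) (by simp)
  · refine .of_rule (.impL {.var p} {.box (.atom a) (.rdia (.atom a) (.var p))} (.var p) .bot) rfl ⟨trivial, trivial⟩ ?_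
    simp only [Rule.premises, List.forall_mem_cons, List.not_mem_nil, false_imp_iff, implies_true,
      and_true]
    constructor
    · exact .of_mem (φ := .var p) (fun _ _ _ => ⟨trivial, trivial⟩) (by simp) (by simp)
    · refine .of_rule (.bot _ _) rfl ⟨trivial, trivial⟩ ?_
      simp [Rule.premises]

theorem Derivable.mono {R R' : Rule P A → Prop} (hR : ∀ r, R r → R' r) {S : Sequent P A}
    (h : Derivable R S) : Derivable R' S := by
  induction h with
  | intro r hr _ ih => exact .intro r (hR r hr) ih

end TPDL

theorem mainTheorem4 {P : Type u} {A : Type v} (p : P) (a : A) :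
    (¬ TPDL.GCutFreeProvable (TPDL.fixpointSequent p a) ∧
      ¬ TPDL.GFLCutProvable (TPDL.fixpointSequent p a) ∧
      TPDL.CGCutFreeProvable (TPDL.fixpointSequent p a)) ∧
    (TPDL.GProvable (TPDL.converseSequent p a) ∧
      TPDL.CGProvable (TPDL.converseSequent p a) ∧
      ¬ TPDL.GCutFreeProvable (TPDL.converseSequent p a) ∧
      ¬ TPDL.CGCutFreeProvable (TPDL.converseSequent p a)) :=
  ⟨⟨fun h => TPDL.not_gflCutProvable_fixpointSequent p a h.gflCutProvable,
      TPDL.not_gflCutProvable_fixpointSequent p a, TPDL.cgCutFreeProvable_fixpointSequent p a⟩,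
    ((TPDL.derivable_converseSequent p a).mono fun _ h => ⟨h.1, trivial⟩).gProvableWith,
    ((TPDL.derivable_converseSequent p a).mono fun _ h => ⟨h.2, trivial⟩).cgProvableWith,
    TPDL.not_gCutFreeProvable_converseSequent p a,
    TPDL.not_cgCutFreeProvable_converseSequent p a⟩
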